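/- Let $\mathbb{F}_2^n$ be the space of $n$-bit vectors. For a random variable ("source") $X$ over $\mathbb{F}_2^n$, its min-entropy is $H_\infty(X)=\min_{x\in\mathrm{supp}(X)}\log_2\frac{1}{\Pr[X=x]}$, and for $f:\mathbb{F}_2^n\to\mathbb{F}_2$ put $\mathrm{bias}_X(f)=\Pr[f(X)=0]-\Pr[f(X)=1]$. A random degree-$d$ polynomial is $f(x)=\sum_{S\subseteq[n],\,|S|\le d}\alpha_S\prod_{i\in S}x_i$ with the coefficients $\alpha_S$ independent and uniform in $\mathbb{F}_2$. Write $\binom{k}{\le d}=\sum_{i=0}^{d}\binom{k}{i}$, where $\binom{k}{i}=k(k-1)\cdots(k-i+1)/i!$ for real $k$. Theorem (Low-degree polynomials extract from a single source). For every $\delta\in(0,1)$ there is a constant $c>0$, depending only on $\delta$, such that the following holds. Let $n\in\mathbb{N}$, let $k$ be a real number, let $X$ be a source over $\mathbb{F}_2^n$ with min-entropy at least $k$, and let $d$ be an integer with $1\le d\le(1-\delta)k$. Then for a random degree-$d$ polynomial $f:\mathbb{F}_2^n\to\mathbb{F}_2$, $$\Pr_f\left[\,|\mathrm{bias}_X(f)|>2^{-ck/d}\,\right]\le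 2^{-c\binom{k}{\le d}}.$$ -/

import Mathlib

/-- The min-entropy (in bits) of a distribution `X` on a finite type: the minimum, over the points
`x` of the support, of `log₂ (1 / Pr[X = x])`. On a finite type the infimum ranges over a finite
nonempty family, so it is a minimum. -/
noncomputable def minEntropy {Ω : Type*} (X : PMF Ω) : ℝ :=
  ⨅ x : X.support, Real.logb 2 (1 / (X (x : Ω)).toReal)

/-- The bias of `f` on an input drawn from `X`: `Pr[f(X) = 0] - Pr[f(X) = 1]`. -/
noncomputable def bias {Ω : Type*} (X : PMF Ω) (f : Ω → ZMod 2) : ℝ :=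
  (X.toOuterMeasure {x | f x = 0}).toReal - (X.toOuterMeasure {x | f x = 1}).toReal

/-- Coefficient vectors `(α_S)` of polynomials of degree at most `d` in `n` variables over `F₂`,
indexed by the sets `S` of variables with `|S| ≤ d`. -/
abbrev PolyCoeffs (n d : ℕ) : Type :=
  {S : Finset (Fin n) // S.card ≤ d} → ZMod 2

/-- The function `x ↦ ∑_{|S| ≤ d} α_S ∏_{i ∈ S} x_i` on `F₂ⁿ`. -/
def evalPoly {n d : ℕ} (α : PolyCoeffs n d) (x : Fin n → ZMod 2) : ZMod 2 :=
  ∑ S, α S * ∏ i ∈ S.1, x i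

/-- The coefficients of a random degree `d` polynomial: independent and uniform in `F₂`, i.e.
uniform on the space of all coefficient vectors. -/
noncomputable def randomPoly (n d : ℕ) : PMF (PolyCoeffs n d) :=
  PMF.uniformOfFintype (PolyCoeffs n d)

/-- The binomial sum `∑_{i ≤ d} (k choose i)`, where `k` may be real and
`(k choose i) = k (k - 1) ⋯ (k - i + 1) / i!`. -/
noncomputable def binomSum (k : ℝ) (d : ℕ) : ℝ :=
  ∑ i ∈ Finset.range (d + 1), Ring.choose k i

/-! The proof bounds the moment of order `2r` of the bias. Averaging over the coefficients turns it
into the weight of the `2r`-tuples of points whose monomial sums vanish in every degree up to `d`.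
This vanishing survives linear maps, so the source may be hashed to `m ≤ k` bits
(`exists_rows_collision_le`). Once the overweight fibres are discarded, each image point has mass
close to `2^{-m}`, and it remains to count vanishing tuples in `F₂^{a+b}`
(`exists_subdistribution_moment_le`).

Write the points as pairs `(y, z)`. The monomials `y_i · g(z)` with `deg g < d` give linear
constraints on the `y`'s. If `r` of the `z`'s are interpolated by polynomials of degree `< d`, the
corresponding `y`'s are determined by the others. Otherwise all the `z`'s lie in the closure of
fewer than `r` points, which is small by the Hilbert function bound `exists_subspace_injOn`. Either
way such tuples are rare.

Take `r = ∑_{i<d} C(l,i)`, with `l` close to `k` and `s` of order `k/d`. Markov's inequality then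
gives failure probability `2^{-rs/2}`. The factor `s` pays for the missing top binomial, as `C(K,d)
≤ (K/d) C(K,d-1)`. Bounded `k` needs only the second moment. -/

/-! ### Counting integers of low binary weight -/

/-- The number of ones in the binary expansion of `i`. -/
def binaryWeight (i : ℕ) : ℕ := (Nat.digits 2 i).sum

/-- The number of integers below `N` whose binary expansion has fewer than `e` ones. -/
def lowWeightCount (e N : ℕ) : ℕ := ((Finset.range N).filter (fun i => binaryWeight i < e)).card

theorem binaryWeight_two_mul (i : ℕ) : binaryWeight (2 * i) = binaryWeight i := by
  rcases Nat.eq_zero_or_pos i with rfl | hi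
  · simp
  · unfold binaryWeight
    rw [Nat.digits_def' (by norm_num) (by omega)]
    simp

theorem binaryWeight_two_mul_add_one (i : ℕ) :
    binaryWeight (2 * i + 1) = binaryWeight i + 1 := by
  unfold binaryWeight
  rw [Nat.digits_def' (by norm_num) (by omega)]
  have h1 : (2 * i + 1) % 2 = 1 := by omega
  have h2 : (2 * i + 1) / 2 = i := by omega
  rw [h1, h2, List.sum_cons, add_comm]

theorem lowWeightCount_zero_right (e : ℕ) : lowWeightCount e 0 = 0 := by
  simp [lowWeightCount]

theorem lowWeightCount_zero_left (N : ℕ) : lowWeightCount 0 N = 0 := by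
  simp [lowWeightCount]

theorem lowWeightCount_succ (e N : ℕ) :
    lowWeightCount e (N + 1) = lowWeightCount e N + if binaryWeight N < e then 1 else 0 := by
  unfold lowWeightCount
  rw [Finset.range_add_one, Finset.filter_insert]
  split_ifs with h
  · rw [Finset.card_insert_of_notMem (by simp)]
  · simp

theorem lowWeightCount_two_mul (e N : ℕ) :
    lowWeightCount (e + 1) (2 * N) = lowWeightCount (e + 1) N + lowWeightCount e N := by
  induction N with
  | zero => simp [lowWeightCount_zero_right]
  | succ N ih =>
    rw [show 2 * (N + 1) = 2 * N + 1 + 1 by ring, lowWeightCount_succ, lowWeightCount_succ, ih,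
      lowWeightCount_succ, lowWeightCount_succ, binaryWeight_two_mul,
      binaryWeight_two_mul_add_one]
    simp only [Nat.add_lt_add_iff_right]
    ring

theorem lowWeightCount_two_mul_add_one (e N : ℕ) :
    lowWeightCount (e + 1) (2 * N + 1) = lowWeightCount (e + 1) (N + 1) + lowWeightCount e N := by
  rw [lowWeightCount_succ, lowWeightCount_two_mul, lowWeightCount_succ, binaryWeight_two_mul]
  ring

theorem lowWeightCount_mono_right (e : ℕ) {N M : ℕ} (h : N ≤ M) :
    lowWeightCount e N ≤ lowWeightCount e M :=
  Finset.card_le_card (Finset.filter_subset_filter _ (Finset.range_subset_range.2 h))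

theorem lowWeightCount_two_pow (e l : ℕ) :
    lowWeightCount e (2 ^ l) = ∑ i ∈ Finset.range e, l.choose i := by
  induction l generalizing e with
  | zero =>
    cases e with
    | zero => simp [lowWeightCount_zero_left]
    | succ e =>
      rw [Finset.sum_range_succ', pow_zero, ← zero_add 1, lowWeightCount_succ]
      simp [lowWeightCount_zero_right, binaryWeight]
  | succ l ih =>
    cases e with
    | zero => simp [lowWeightCount_zero_left]
    | succ e =>
      rw [pow_succ', lowWeightCount_two_mul, ih, ih, Finset.sum_range_succ',
        Finset.sum_range_succ' (fun i => (l + 1).choose i)]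
      simp only [Nat.choose_succ_succ, Finset.sum_add_distrib, Nat.choose_zero_right]
      ring

/-- Among the initial segments of the integers, splitting off a smaller part with one bit less of
weight does not lose elements. -/
theorem lowWeightCount_add_le (e A B : ℕ) (h : B ≤ A) :
    lowWeightCount (e + 1) (A + B) ≤ lowWeightCount (e + 1) A + lowWeightCount e B := by
  induction hN : A + B using Nat.strong_induction_on generalizing e A B with
  | _ N ih =>
  subst hN
  rcases Nat.eq_zero_or_pos B with rfl | hB
  · simp
  -- At `e = 0` the truncated `e - 1` is harmless: all counts with bound `0` vanish.
  have prev : ∀ A' B', B' ≤ A' → A' + B' < A + B →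
      lowWeightCount e (A' + B') ≤ lowWeightCount e A' + lowWeightCount (e - 1) B' := by
    intro A' B' h' hlt
    cases e with
    | zero => simp [lowWeightCount_zero_left]
    | succ e => exact ih _ hlt e A' B' h' rfl
  have cur : ∀ A' B', B' ≤ A' → A' + B' < A + B →
      lowWeightCount (e + 1) (A' + B') ≤ lowWeightCount (e + 1) A' + lowWeightCount e B' :=
    fun A' B' h' hlt => ih _ hlt e A' B' h' rfl
  have even : ∀ N, lowWeightCount e (2 * N) = lowWeightCount e N + lowWeightCount (e - 1) N := by
    intro N
    cases e with
    | zero => simp [lowWeightCount_zero_left]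
    | succ e => exact lowWeightCount_two_mul e N
  have odd : ∀ N, lowWeightCount e (2 * N + 1) =
      lowWeightCount e (N + 1) + lowWeightCount (e - 1) N := by
    intro N
    cases e with
    | zero => simp [lowWeightCount_zero_left]
    | succ e => exact lowWeightCount_two_mul_add_one e N
  -- Halving splits every count by its last bit into one with bound `e + 1` and one with bound `e`;
  -- induction applies to each.
  obtain ⟨a, rfl | rfl⟩ := Nat.even_or_odd' A <;> obtain ⟨b, rfl | rfl⟩ := Nat.even_or_odd' B
  · rw [← mul_add, lowWeightCount_two_mul, lowWeightCount_two_mul, even]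
    have h1 := cur a b (by omega) (by omega)
    have h2 := prev a b (by omega) (by omega)
    omega
  · rw [show 2 * a + (2 * b + 1) = 2 * (a + b) + 1 by ring, lowWeightCount_two_mul_add_one,
      lowWeightCount_two_mul, odd]
    have h1 := cur a (b + 1) (by omega) (by omega)
    have h2 := prev a b (by omega) (by omega)
    rw [← add_assoc] at h1
    omega
  · rw [show 2 * a + 1 + 2 * b = 2 * (a + b) + 1 by ring, lowWeightCount_two_mul_add_one,
      lowWeightCount_two_mul_add_one, even]
    have h1 := cur (a + 1) b (by omega) (by omega)
    have h2 := prev a b (by omega) (by omega)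
    rw [show a + 1 + b = a + b + 1 by ring] at h1
    omega
  · rw [show 2 * a + 1 + (2 * b + 1) = 2 * (a + b + 1) by ring, lowWeightCount_two_mul,
      lowWeightCount_two_mul_add_one, odd]
    rcases Nat.eq_or_lt_of_le (show b ≤ a by omega) with rfl | hlt
    · rw [show b + b + 1 = 2 * b + 1 by ring, lowWeightCount_two_mul_add_one, odd]
    · have h1 := cur (a + 1) b (by omega) (by omega)
      have h2 := prev a (b + 1) (by omega) (by omega)
      rw [show a + 1 + b = a + b + 1 by ring] at h1
      rw [← add_assoc] at h2
      -- The induction hypotheses carry `b` and `b + 1` the wrong way round. Exchanging them is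
      -- allowed since weight `< e - 1` implies weight `< e`.
      have h3 := lowWeightCount_succ e b
      have h4 := lowWeightCount_succ (e - 1) b
      split_ifs at h3 h4 <;> omega

/-! ### Hilbert functions of point sets -/

/-- The monomial function `x ↦ ∏_{i ∈ S} x_i`. -/
def monomialFun {ι : Type*} (S : Finset ι) (x : ι → ZMod 2) : ZMod 2 := ∏ i ∈ S, x i

/-- The functions on `F₂ᵇ` given by polynomials of degree less than `e`. -/
def polySpace (e b : ℕ) : Submodule (ZMod 2) ((Fin b → ZMod 2) → ZMod 2) :=
  Submodule.span (ZMod 2) {g | ∃ S : Finset (Fin b), S.card < e ∧ g = monomialFun S}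

/-- The map `(g, h) ↦ g + x₀ h` from pairs of functions in the last `b` variables. -/
def consPoly (b : ℕ) :
    (((Fin b → ZMod 2) → ZMod 2) × ((Fin b → ZMod 2) → ZMod 2)) →ₗ[ZMod 2]
      ((Fin (b + 1) → ZMod 2) → ZMod 2) where
  toFun gh x := gh.1 (Fin.tail x) + x 0 * gh.2 (Fin.tail x)
  map_add' u v := by
    funext x
    simp only [Prod.fst_add, Prod.snd_add, Pi.add_apply]
    ring
  map_smul' c u := by
    funext x
    simp only [Prod.smul_fst, Prod.smul_snd, Pi.smul_apply, smul_eq_mul, RingHom.id_apply]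
    ring

theorem consPoly_apply {b : ℕ} (g h : (Fin b → ZMod 2) → ZMod 2) (x : Fin (b + 1) → ZMod 2) :
    consPoly b (g, h) x = g (Fin.tail x) + x 0 * h (Fin.tail x) := rfl

theorem consPoly_injective (b : ℕ) : Function.Injective (consPoly b) := by
  rw [← LinearMap.ker_eq_bot, LinearMap.ker_eq_bot']
  rintro ⟨g, h⟩ H
  have hg : g = 0 := by
    funext z
    have := congrFun H (Fin.cons 0 z)
    simpa [consPoly_apply] using this
  have hh : h = 0 := by
    funext z
    have := congrFun H (Fin.cons 1 z)
    simpa [consPoly_apply, hg] using this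
  rw [hg, hh]
  rfl

theorem consPoly_mem_polySpace {e b : ℕ} {g h : (Fin b → ZMod 2) → ZMod 2}
    (hg : g ∈ polySpace (e + 1) b) (hh : h ∈ polySpace e b) :
    consPoly b (g, h) ∈ polySpace (e + 1) (b + 1) := by
  have h1 : consPoly b (g, 0) ∈ polySpace (e + 1) (b + 1) := by
    have : polySpace (e + 1) b ≤
        (polySpace (e + 1) (b + 1)).comap (consPoly b ∘ₗ LinearMap.inl _ _ _) := by
      refine Submodule.span_le.2 ?_
      rintro _ ⟨S, hS, rfl⟩
      refine Submodule.subset_span ⟨S.map (Fin.succEmb b), by simpa using hS, ?_⟩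
      funext x
      simp [consPoly_apply, monomialFun, Fin.tail]
    exact this hg
  have h2 : consPoly b (0, h) ∈ polySpace (e + 1) (b + 1) := by
    have : polySpace e b ≤
        (polySpace (e + 1) (b + 1)).comap (consPoly b ∘ₗ LinearMap.inr _ _ _) := by
      refine Submodule.span_le.2 ?_
      rintro _ ⟨S, hS, rfl⟩
      have h0 : (0 : Fin (b + 1)) ∉ S.map (Fin.succEmb b) := by simp [Fin.succ_ne_zero]
      refine Submodule.subset_span ⟨insert 0 (S.map (Fin.succEmb b)), ?_, ?_⟩
      · rw [Finset.card_insert_of_notMem h0]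
        simpa using hS
      · funext x
        simp [consPoly_apply, monomialFun, Fin.tail, Finset.prod_insert h0]
    exact this hh
  have := add_mem h1 h2
  rwa [← map_add, Prod.mk_add_mk, add_zero, zero_add] at this

/-- A lower bound for the Hilbert function of a set of `N` points of `F₂ᵇ`: some space of
polynomials of degree less than `e`, of dimension at least the number of integers below `N` with
fewer than `e` binary ones, restricts injectively to the set. -/
theorem exists_subspace_injOn (b e : ℕ) (C : Finset (Fin b → ZMod 2)) :
    ∃ Q : Submodule (ZMod 2) ((Fin b → ZMod 2) → ZMod 2), Q ≤ polySpace e b ∧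
      lowWeightCount e C.card ≤ Module.finrank (ZMod 2) Q ∧
      ∀ q ∈ Q, (∀ z ∈ C, q z = 0) → q = 0 := by
  classical
  induction b generalizing e with
  | zero =>
    rcases C.eq_empty_or_nonempty with rfl | ⟨z₀, hz₀⟩
    · exact ⟨⊥, bot_le, by simp [lowWeightCount_zero_right], fun q hq _ => by simpa using hq⟩
    cases e with
    | zero =>
      exact ⟨⊥, bot_le, by simp [lowWeightCount_zero_left], fun q hq _ => by simpa using hq⟩
    | succ e =>
      refine ⟨Submodule.span (ZMod 2) {monomialFun ∅}, ?_, ?_, ?_⟩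
      · rw [Submodule.span_singleton_le_iff_mem]
        exact Submodule.subset_span ⟨∅, by simp, rfl⟩
      · rw [finrank_span_singleton]
        · have hc : C.card ≤ 1 := by
            simpa using Finset.card_le_univ C
          refine (Finset.card_filter_le _ _).trans (by simpa using hc)
        · intro h
          have := congrFun h z₀
          simp [monomialFun] at this
      · intro q _ hq'
        funext z
        rw [Subsingleton.elim z z₀]
        exact hq' z₀ hz₀
  | succ b ih =>
    cases e with
    | zero =>
      exact ⟨⊥, bot_le, by simp [lowWeightCount_zero_left], fun q hq _ => by simpa using hq⟩
    | succ e =>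
      let S : ZMod 2 → Finset (Fin b → ZMod 2) :=
        fun u => Finset.univ.filter fun z => (Fin.cons u z : Fin (b + 1) → ZMod 2) ∈ C
      have hcard : C.card = (S 0 ∪ S 1).card + (S 0 ∩ S 1).card := by
        rw [Finset.card_union_add_card_inter]
        have : ∀ u, (S u).card = (C.filter fun x => x 0 = u).card := by
          intro u
          refine Finset.card_bij (fun z _ => Fin.cons u z) ?_ ?_ ?_
          · intro z hz
            simpa [S] using hz
          · intro z _ z' _ h
            exact Fin.cons_right_injective (α := fun _ => ZMod 2) u h
          · intro x hx
            rw [Finset.mem_filter] at hx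
            have hx' : (Fin.cons u (Fin.tail x) : Fin (b + 1) → ZMod 2) = x := by
              rw [← hx.2]; exact Fin.cons_self_tail x
            exact ⟨Fin.tail x, by simpa [S, hx'] using hx.1, hx'⟩
        rw [this, this, ← Finset.card_filter_add_card_filter_not (s := C) (fun x => x 0 = 0)]
        congr 2
        refine Finset.filter_congr fun x _ => ?_
        generalize x 0 = u
        revert u
        decide
      obtain ⟨Q₀, hQ₀, hr₀, hi₀⟩ := ih (e + 1) (S 0 ∪ S 1)
      obtain ⟨Q₁, hQ₁, hr₁, hi₁⟩ := ih e (S 0 ∩ S 1)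
      -- Use `g + x₀ h` with `g ∈ Q₀`, `h ∈ Q₁`. If it vanishes on `C`, then `h` vanishes on the
      -- common part of the two slices, so `h = 0`; then `g` vanishes on their union.
      refine ⟨LinearMap.range (consPoly b ∘ₗ Q₀.subtype.prodMap Q₁.subtype), ?_, ?_, ?_⟩
      · rintro _ ⟨⟨g, h⟩, rfl⟩
        exact consPoly_mem_polySpace (hQ₀ g.2) (hQ₁ h.2)
      · rw [LinearMap.finrank_range_of_inj, Module.finrank_prod, hcard]
        swap
        · exact (consPoly_injective b).comp
            (Q₀.subtype_injective.prodMap Q₁.subtype_injective)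
        refine (lowWeightCount_add_le e _ _ (Finset.card_le_card ?_)).trans (by omega)
        exact Finset.inter_subset_left.trans Finset.subset_union_left
      · rintro _ ⟨⟨⟨g, hgQ⟩, ⟨h, hhQ⟩⟩, rfl⟩ hz
        change ∀ z ∈ C, consPoly b (g, h) z = 0 at hz
        change consPoly b (g, h) = 0
        have h0 : ∀ z ∈ S 0, g z = 0 := by
          intro z hzS
          simpa [consPoly_apply] using hz (Fin.cons 0 z) (by simpa [S] using hzS)
        have h1 : ∀ z ∈ S 1, g z + h z = 0 := by
          intro z hzS
          simpa [consPoly_apply] using hz (Fin.cons 1 z) (by simpa [S] using hzS)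
        have hh : h = 0 := by
          refine hi₁ h hhQ fun z hz => ?_
          rw [Finset.mem_inter] at hz
          simpa [h0 z hz.1] using h1 z hz.2
        have hg : g = 0 := by
          refine hi₀ g hgQ fun z hz => ?_
          rcases Finset.mem_union.1 hz with hz | hz
          · exact h0 z hz
          · simpa [hh] using h1 z hz
        rw [hg, hh]
        exact map_zero (consPoly b)

/-! ### Closures and interpolation -/

/-- The points at which every polynomial of degree less than `e` vanishing on `s` vanishes. -/
noncomputable def polyClosure {b : ℕ} (e : ℕ) (s : Finset (Fin b → ZMod 2)) :
    Finset (Fin b → ZMod 2) := by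
  classical
  exact Finset.univ.filter fun z => ∀ p ∈ polySpace e b, (∀ w ∈ s, p w = 0) → p z = 0

theorem mem_polyClosure {b e : ℕ} {s : Finset (Fin b → ZMod 2)} {z : Fin b → ZMod 2} :
    z ∈ polyClosure e s ↔ ∀ p ∈ polySpace e b, (∀ w ∈ s, p w = 0) → p z = 0 := by
  simp [polyClosure]

/-- On a space that restricts injectively to the closure, restriction to `s` is already injective,
so its dimension is at most `s.card`. -/
theorem card_polyClosure_lt {b e L : ℕ} {s : Finset (Fin b → ZMod 2)}
    (hs : s.card < lowWeightCount e L) : (polyClosure e s).card < L := by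
  by_contra! hL
  obtain ⟨Q, hQ, hr, hi⟩ := exists_subspace_injOn b e (polyClosure e s)
  have hlt : s.card < Module.finrank (ZMod 2) Q :=
    hs.trans_le ((lowWeightCount_mono_right e hL).trans hr)
  let R : Q →ₗ[ZMod 2] (s → ZMod 2) := LinearMap.pi fun w => LinearMap.proj w.1 ∘ₗ Q.subtype
  have hR : Function.Injective R := by
    rw [← LinearMap.ker_eq_bot, LinearMap.ker_eq_bot']
    rintro ⟨q, hq⟩ h0
    refine Subtype.ext (hi q hq fun z hz => ?_)
    exact mem_polyClosure.1 hz q (hQ hq) fun w hw => congrFun h0 ⟨w, hw⟩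
  have := LinearMap.finrank_le_finrank_of_injective hR
  rw [Module.finrank_fintype_fun_eq_card, Fintype.card_coe] at this
  omega

/-- Polynomials of degree less than `e` take arbitrary values at the points `z j`, `j ∈ T`. -/
def Interpolates {b : ℕ} (e : ℕ) {τ : Type*} (z : τ → Fin b → ZMod 2) (T : Finset τ) : Prop :=
  ∀ v : τ → ZMod 2, ∃ p ∈ polySpace e b, ∀ j ∈ T, p (z j) = v j

theorem Interpolates.mono {b e : ℕ} {τ : Type*} {z : τ → Fin b → ZMod 2} {T T' : Finset τ}
    (h : Interpolates e z T) (hT : T' ⊆ T) : Interpolates e z T' := fun v =>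
  let ⟨p, hp, hv⟩ := h v
  ⟨p, hp, fun j hj => hv j (hT hj)⟩

-- Take a maximal interpolated `T`. A polynomial vanishing on `T` but not at some `z j` would allow
-- `j` to be added.
open Classical in
theorem exists_interpolates_or_mem_closure {b : ℕ} (e r : ℕ) {τ : Type*} [Fintype τ]
    (z : τ → Fin b → ZMod 2) :
    (∃ T : Finset τ, T.card = r ∧ Interpolates e z T) ∨
      ∃ T : Finset τ, T.card < r ∧ ∀ j, z j ∈ polyClosure e (T.image z) := by
  obtain ⟨T, hT, hmax⟩ := Finset.exists_max_image
    (Finset.univ.filter fun T : Finset τ => Interpolates e z T) Finset.card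
    ⟨∅, Finset.mem_filter.2 ⟨Finset.mem_univ _, fun v => ⟨0, zero_mem _, by simp⟩⟩⟩
  simp only [Finset.mem_filter, Finset.mem_univ, true_and] at hT hmax
  by_cases hr : r ≤ T.card
  · obtain ⟨T', hT', hc⟩ := Finset.exists_subset_card_eq hr
    exact Or.inl ⟨T', hc, hT.mono hT'⟩
  refine Or.inr ⟨T, by omega, fun j => mem_polyClosure.2 fun p hp h0 => ?_⟩
  by_contra hpj
  have hp1 : p (z j) = 1 := by
    generalize p (z j) = u at hpj
    revert u
    decide
  have hp0 : ∀ i ∈ T, p (z i) = 0 := fun i hi => h0 _ (Finset.mem_image_of_mem z hi)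
  have hj : j ∉ T := fun hj => hpj (hp0 j hj)
  have : Interpolates e z (insert j T) := by
    intro v
    obtain ⟨q, hq, hqv⟩ := hT v
    refine ⟨q + (v j - q (z j)) • p, add_mem hq (Submodule.smul_mem _ _ hp), ?_⟩
    intro i hi
    rcases Finset.mem_insert.1 hi with rfl | hi
    · simp [hp1]
    · simp [hp0 i hi, hqv i hi]
  have := hmax _ this
  rw [Finset.card_insert_of_notMem hj] at this
  omega

/-- Counting tuples all of whose entries off `T` lie in a set determined by the entries on `T`. -/
theorem card_filter_determined_le {α τ : Type*} [Fintype α] [DecidableEq α] [Fintype τ]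
    [DecidableEq τ] (T : Finset τ) (F : Finset α → Finset α) (L : ℕ)
    (hF : ∀ s : Finset α, s.card ≤ T.card → (F s).card ≤ L) :
    (Finset.univ.filter fun z : τ → α => ∀ j, z j ∈ F (T.image z)).card ≤
      Fintype.card α ^ T.card * L ^ (Fintype.card τ - T.card) := by
  let res : (τ → α) → (T → α) := fun z j => z j
  have hfib : ∀ u ∈ (Finset.univ : Finset (T → α)),
      ((Finset.univ.filter fun z : τ → α => ∀ j, z j ∈ F (T.image z)).filter
        fun z => res z = u).card ≤ L ^ (Fintype.card τ - T.card) := by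
    intro u _
    -- The entries on `T` fix the image of `T`, hence the set that must contain all other entries.
    let s : Finset α := Finset.univ.image u
    have hs : s.card ≤ T.card := by
      have := Finset.card_image_le (s := Finset.univ) (f := u)
      rwa [Finset.card_univ, Fintype.card_coe] at this
    calc _ ≤ (Fintype.piFinset fun j : τ => if h : j ∈ T then {u ⟨j, h⟩} else F s).card := by
          refine Finset.card_le_card fun z hz => ?_
          simp only [Finset.mem_filter, Finset.mem_univ, true_and] at hz
          obtain ⟨hz, rfl⟩ := hz
          have hsz : s = T.image z := by
            ext a
            simp [s, res]
          rw [Fintype.mem_piFinset]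
          intro j
          split_ifs with h
          · simp [res]
          · rw [hsz]; exact hz j
      _ = ∏ j : τ, if j ∈ T then 1 else (F s).card := by
          rw [Fintype.card_piFinset]
          refine Finset.prod_congr rfl fun j _ => ?_
          split_ifs <;> simp
      _ = (F s).card ^ (Fintype.card τ - T.card) := by
          rw [Finset.prod_ite]
          simp only [Finset.prod_const_one, one_mul, Finset.prod_const]
          congr 1
          rw [← Finset.card_compl]
          congr 1
          ext j
          simp
      _ ≤ _ := Nat.pow_le_pow_left (hF s hs) _
  refine (Finset.card_le_mul_card_image_of_maps_to (f := res) (t := Finset.univ)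
    (fun _ _ => Finset.mem_univ _) _ hfib).trans (le_of_eq ?_)
  rw [mul_comm]
  simp

open Classical in
/-- Few tuples of points fail to contain `r` points at which polynomials of degree less than `e`
take arbitrary values. -/
theorem card_not_interpolates_le {b e r l : ℕ} {τ : Type*} [Fintype τ] (hlb : l ≤ b)
    (hr : r ≤ lowWeightCount e (2 ^ l)) (hrt : r ≤ Fintype.card τ) :
    (Finset.univ.filter fun z : τ → Fin b → ZMod 2 =>
      ¬ ∃ T : Finset τ, T.card = r ∧ Interpolates e z T).card ≤
        2 ^ Fintype.card τ * 2 ^ (b * r + l * (Fintype.card τ - r)) := by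
  calc _ ≤ ((Finset.univ.filter fun T : Finset τ => T.card < r).biUnion fun T =>
          Finset.univ.filter fun z : τ → Fin b → ZMod 2 =>
            ∀ j, z j ∈ polyClosure e (T.image z)).card := by
        refine Finset.card_le_card fun z hz => ?_
        rw [Finset.mem_filter] at hz
        obtain ⟨T, hT, h⟩ := (exists_interpolates_or_mem_closure e r z).resolve_left hz.2
        simp only [Finset.mem_biUnion, Finset.mem_filter, Finset.mem_univ, true_and]
        exact ⟨T, hT, h⟩
    _ ≤ (Finset.univ.filter fun T : Finset τ => T.card < r).card *
          2 ^ (b * r + l * (Fintype.card τ - r)) := by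
        refine Finset.card_biUnion_le_card_mul _ _ _ fun T hT => ?_
        rw [Finset.mem_filter] at hT
        refine (card_filter_determined_le T (polyClosure e) (2 ^ l) fun s hs =>
          (card_polyClosure_lt (by omega)).le).trans ?_
        simp only [Fintype.card_fun, ZMod.card, Fintype.card_fin]
        rw [← pow_mul, ← pow_mul, ← pow_add]
        refine Nat.pow_le_pow_right (by norm_num) ?_
        -- Since `l ≤ b`, the exponent `b |T| + l (t - |T|)` increases with `|T|`, so `|T| = r`
        -- bounds it.
        obtain ⟨c, rfl⟩ := Nat.exists_eq_add_of_le hlb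
        obtain ⟨w, hw⟩ := Nat.exists_eq_add_of_lt hT.2
        obtain ⟨v, hv⟩ := Nat.exists_eq_add_of_le hrt
        rw [hv, Nat.add_sub_cancel_left, hw,
          show T.card + w + 1 + v - T.card = w + 1 + v by omega]
        nlinarith [Nat.zero_le (c * (w + 1))]
    _ ≤ _ := by
        refine Nat.mul_le_mul_right _ ((Finset.card_filter_le _ _).trans ?_)
        simp

/-! ### Counting annihilating pairs -/

/-- The tuples of vectors `y j` in `F₂ᵃ` orthogonal, coordinate by coordinate, to the values of all
polynomials of degree less than `e` at the points `z j`. -/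
def Annihilates {a b : ℕ} (e : ℕ) {τ : Type*} [Fintype τ] (z : τ → Fin b → ZMod 2)
    (y : τ → Fin a → ZMod 2) : Prop :=
  ∀ i : Fin a, ∀ S : Finset (Fin b), S.card < e → ∑ j, y j i * monomialFun S (z j) = 0

theorem Annihilates.sum_eq_zero {a b e : ℕ} {τ : Type*} [Fintype τ] {z : τ → Fin b → ZMod 2}
    {y : τ → Fin a → ZMod 2} (h : Annihilates e z y) (i : Fin a)
    {p : (Fin b → ZMod 2) → ZMod 2} (hp : p ∈ polySpace e b) : ∑ j, y j i * p (z j) = 0 := by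
  induction hp using Submodule.span_induction with
  | mem p hp =>
    obtain ⟨S, hS, rfl⟩ := hp
    exact h i S hS
  | zero => simp
  | add p q _ _ hp hq => simp [mul_add, Finset.sum_add_distrib, hp, hq]
  | smul c p _ hp =>
    simp only [Pi.smul_apply, smul_eq_mul, mul_left_comm _ c, ← Finset.mul_sum, hp, mul_zero]

-- The entries off `T` determine the rest: pairing the difference of two solutions with a polynomial
-- equal to the indicator of `j` on `T` isolates entry `j`.
open Classical in
theorem card_annihilates_le {a b e : ℕ} {τ : Type*} [Fintype τ] (z : τ → Fin b → ZMod 2)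
    {T : Finset τ} (hT : Interpolates e z T) :
    (Finset.univ.filter fun y : τ → Fin a → ZMod 2 => Annihilates e z y).card ≤
      2 ^ (a * (Fintype.card τ - T.card)) := by
  calc _ ≤ (Finset.univ : Finset ({j // j ∉ T} → Fin a → ZMod 2)).card := by
        refine Finset.card_le_card_of_injOn (fun y j => y j) (fun _ _ => Finset.mem_univ _) ?_
        intro y hy y' hy' hyy
        simp only [Finset.coe_filter, Finset.mem_univ, true_and, Set.mem_ofPred_eq] at hy hy'
        have hoff : ∀ j ∉ T, y j = y' j := fun j hj => congrFun hyy ⟨j, hj⟩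
        funext j i
        by_cases hj : j ∈ T
        · obtain ⟨p, hp, hpv⟩ := hT (Pi.single j 1)
          have h1 : ∑ j', (y j' i - y' j' i) * p (z j') = 0 := by
            simp only [sub_mul, Finset.sum_sub_distrib, hy.sum_eq_zero i hp,
              hy'.sum_eq_zero i hp, sub_zero]
          rw [Finset.sum_eq_single j] at h1
          · rw [hpv j hj, Pi.single_eq_same, mul_one] at h1
            exact sub_eq_zero.1 h1
          · intro j' _ hne
            by_cases hj' : j' ∈ T
            · rw [hpv j' hj', Pi.single_eq_of_ne hne, mul_zero]
            · rw [hoff j' hj', sub_self, zero_mul]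
          · simp
        · rw [hoff j hj]
    _ = _ := by
        rw [Finset.card_univ, Fintype.card_fun, Fintype.card_fun, ZMod.card, Fintype.card_fin,
          Fintype.card_subtype_compl, Fintype.card_coe, ← pow_mul]

open Classical in
theorem card_annihilating_pairs_le {a b e r l : ℕ} {τ : Type*} [Fintype τ] (hlb : l ≤ b)
    (hr : r ≤ lowWeightCount e (2 ^ l)) (hrt : r ≤ Fintype.card τ) :
    (Finset.univ.filter fun w : (τ → Fin a → ZMod 2) × (τ → Fin b → ZMod 2) =>
      Annihilates e w.2 w.1).card ≤
        2 ^ (b * Fintype.card τ) * 2 ^ (a * (Fintype.card τ - r)) +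
        2 ^ Fintype.card τ * 2 ^ (b * r + l * (Fintype.card τ - r)) *
          2 ^ (a * Fintype.card τ) := by
  let N : (τ → Fin b → ZMod 2) → ℕ := fun z =>
    (Finset.univ.filter fun y : τ → Fin a → ZMod 2 => Annihilates e z y).card
  let good : (τ → Fin b → ZMod 2) → Prop := fun z =>
    ∃ T : Finset τ, T.card = r ∧ Interpolates e z T
  have hsum : (Finset.univ.filter fun w : (τ → Fin a → ZMod 2) × (τ → Fin b → ZMod 2) =>
      Annihilates e w.2 w.1).card = ∑ z, N z := by
    simp only [N, Finset.card_filter, Fintype.sum_prod_type]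
    exact Finset.sum_comm
  rw [hsum, ← Finset.sum_filter_add_sum_filter_not Finset.univ good]
  refine add_le_add ?_ ?_
  · calc _ ≤ (Finset.univ.filter good).card • 2 ^ (a * (Fintype.card τ - r)) := by
          refine Finset.sum_le_card_nsmul _ _ _ fun z hz => ?_
          obtain ⟨T, hT, h⟩ := (Finset.mem_filter.1 hz).2
          rw [← hT]
          exact card_annihilates_le z h
      _ ≤ _ := by
          rw [smul_eq_mul]
          refine Nat.mul_le_mul_right _ ((Finset.card_filter_le _ _).trans (le_of_eq ?_))
          simp [← pow_mul]
  · calc _ ≤ (Finset.univ.filter fun z => ¬ good z).card • 2 ^ (a * Fintype.card τ) := by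
          refine Finset.sum_le_card_nsmul _ _ _ fun z _ => ?_
          refine (Finset.card_filter_le _ _).trans (le_of_eq ?_)
          simp [← pow_mul]
      _ ≤ _ := by
          rw [smul_eq_mul]
          exact Nat.mul_le_mul_right _ (card_not_interpolates_le hlb hr hrt)

/-! ### Characters and moments of the bias -/

/-- The nontrivial character of `F₂`. -/
def signChar (u : ZMod 2) : ℝ := if u = 0 then 1 else -1

theorem signChar_zero : signChar 0 = 1 := by simp [signChar]

theorem signChar_one : signChar 1 = -1 := by simp [signChar]

theorem zmod_two_cases (u : ZMod 2) : u = 0 ∨ u = 1 := by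
  revert u
  decide

theorem signChar_add (u v : ZMod 2) : signChar (u + v) = signChar u * signChar v := by
  rcases zmod_two_cases u with rfl | rfl <;> rcases zmod_two_cases v with rfl | rfl <;>
    simp [signChar_zero, signChar_one, CharTwo.add_self_eq_zero]

theorem abs_signChar (u : ZMod 2) : |signChar u| = 1 := by
  rcases zmod_two_cases u with rfl | rfl <;> simp [signChar_zero, signChar_one]

theorem signChar_sum {τ : Type*} (s : Finset τ) (f : τ → ZMod 2) :
    signChar (∑ j ∈ s, f j) = ∏ j ∈ s, signChar (f j) := by
  classical
  induction s using Finset.induction_on with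
  | empty => simp [signChar_zero]
  | insert j s hj ih => rw [Finset.sum_insert hj, Finset.prod_insert hj, signChar_add, ih]

theorem sum_signChar_eq_zero {κ : Type*} [Fintype κ] [DecidableEq κ] {v : κ → ZMod 2}
    (hv : v ≠ 0) : ∑ u : κ → ZMod 2, signChar (∑ i, u i * v i) = 0 := by
  obtain ⟨i, hi⟩ := Function.ne_iff.1 hv
  have hi1 : v i = 1 := (zmod_two_cases _).resolve_left hi
  have h := Equiv.sum_comp (Equiv.addRight (Pi.single i (1 : ZMod 2) : κ → ZMod 2))
    fun u => signChar (∑ i, u i * v i)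
  have h2 : ∀ u : κ → ZMod 2,
      signChar (∑ i', (Equiv.addRight (Pi.single i (1 : ZMod 2) : κ → ZMod 2)) u i' * v i') =
        -signChar (∑ i, u i * v i) := by
    intro u
    simp only [Equiv.coe_addRight, Pi.add_apply, add_mul, Finset.sum_add_distrib, signChar_add]
    have : ∑ i', (Pi.single i (1 : ZMod 2) : κ → ZMod 2) i' * v i' = 1 := by
      rw [Finset.sum_eq_single i] <;> simp +contextual [hi1]
    rw [this, signChar_one, mul_neg_one]
  rw [Finset.sum_congr rfl fun u _ => h2 u, Finset.sum_neg_distrib] at h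
  linarith

/-- The evaluations of the monomials of degree at most `d` at the points `x j` sum to zero. -/
def MonomialSumsVanish {ι τ : Type*} [Fintype τ] (d : ℕ) (x : τ → ι → ZMod 2) : Prop :=
  ∀ S : Finset ι, S.card ≤ d → ∑ j, monomialFun S (x j) = 0

-- The product is a character of `α` whose coefficients are the monomial sums; it averages to zero
-- unless they all vanish.
open Classical in
theorem sum_prod_signChar_evalPoly {n d : ℕ} {τ : Type*} [Fintype τ] (x : τ → Fin n → ZMod 2) :
    ∑ α : PolyCoeffs n d, ∏ j, signChar (evalPoly α (x j)) =
      if MonomialSumsVanish d x then (Fintype.card (PolyCoeffs n d) : ℝ) else 0 := by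
  let v : {S : Finset (Fin n) // S.card ≤ d} → ZMod 2 := fun S => ∑ j, monomialFun S.1 (x j)
  have h1 : ∀ α : PolyCoeffs n d, ∏ j, signChar (evalPoly α (x j)) =
      signChar (∑ S, α S * v S) := by
    intro α
    rw [← signChar_sum]
    congr 1
    simp only [evalPoly, v, Finset.mul_sum, monomialFun]
    exact Finset.sum_comm
  simp only [h1]
  split_ifs with h
  · have hv : v = 0 := funext fun S => h S.1 S.2
    simp [hv, signChar_zero]
  · refine sum_signChar_eq_zero fun hv => h fun S hS => congrFun hv ⟨S, hS⟩

open Classical in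
theorem sum_pow_signChar_evalPoly {n d : ℕ} (w : (Fin n → ZMod 2) → ℝ) (t : ℕ) :
    ∑ α : PolyCoeffs n d, (∑ x, w x * signChar (evalPoly α x)) ^ t =
      Fintype.card (PolyCoeffs n d) * ∑ x : Fin t → Fin n → ZMod 2,
        if MonomialSumsVanish d x then ∏ j, w (x j) else 0 := by
  simp only [Fintype.sum_pow, Finset.prod_mul_distrib]
  rw [Finset.sum_comm, Finset.mul_sum]
  refine Finset.sum_congr rfl fun x _ => ?_
  rw [← Finset.mul_sum, sum_prod_signChar_evalPoly]
  split_ifs <;> ring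

/-! ### Linear hashing -/

theorem pow_eq_self_of_zmod_two (u : ZMod 2) {m : ℕ} (hm : m ≠ 0) : u ^ m = u := by
  rcases zmod_two_cases u with rfl | rfl
  · exact zero_pow hm
  · exact one_pow m

/-- The linear map `F₂ⁿ → F₂^ι` with the given rows. -/
def applyRows {ι : Type*} {n : ℕ} (M : ι → Fin n → ZMod 2) (x : Fin n → ZMod 2) : ι → ZMod 2 :=
  fun i => ∑ c, M i c * x c

theorem MonomialSumsVanish.applyRows {ι τ : Type*} [Fintype τ] {n d : ℕ}
    {x : τ → Fin n → ZMod 2} (h : MonomialSumsVanish d x) (M : ι → Fin n → ZMod 2) :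
    MonomialSumsVanish d fun j => applyRows M (x j) := by
  classical
  intro I hI
  have hexp : ∀ j, monomialFun I (_root_.applyRows M (x j)) =
      ∑ φ ∈ I.pi fun _ => (Finset.univ : Finset (Fin n)),
        (∏ i ∈ I.attach, M i.1 (φ i.1 i.2)) *
          monomialFun (I.attach.image fun i => φ i.1 i.2) (x j) := by
    intro j
    unfold monomialFun _root_.applyRows
    rw [Finset.prod_sum]
    refine Finset.sum_congr rfl fun φ _ => ?_
    rw [Finset.prod_mul_distrib]
    congr 1
    -- Variables chosen repeatedly collapse because `u ^ m = u`, so the degree never exceeds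
    -- `I.card`.
    rw [Finset.prod_comp (fun c => x j c) (fun i : I => φ i.1 i.2)]
    refine Finset.prod_congr rfl fun c hc => pow_eq_self_of_zmod_two _ ?_
    obtain ⟨i, hi, hic⟩ := Finset.mem_image.1 hc
    exact Finset.card_ne_zero_of_mem (Finset.mem_filter.2 ⟨hi, hic⟩)
  simp only [hexp]
  rw [Finset.sum_comm]
  refine Finset.sum_eq_zero fun φ _ => ?_
  rw [← Finset.mul_sum, h, mul_zero]
  exact Finset.card_image_le.trans (by simpa using hI)

/-- Some linear map to `F₂^ι` has collision probability at most `2 · 2^{-|ι|}` on a distribution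
with point masses at most `2^{-|ι|}`. -/
theorem exists_rows_collision_le {ι : Type*} [Fintype ι] [DecidableEq ι] {n : ℕ}
    (p : (Fin n → ZMod 2) → ℝ) (hp0 : ∀ x, 0 ≤ p x) (hp1 : ∑ x, p x = 1)
    (hp : ∀ x, p x ≤ (1 / 2) ^ Fintype.card ι) :
    ∃ M : ι → Fin n → ZMod 2,
      ∑ x, ∑ x', (if applyRows M x = applyRows M x' then p x * p x' else 0) ≤
        2 * (1 / 2) ^ Fintype.card ι := by
  classical
  have hcount : ∀ x x' : Fin n → ZMod 2, x ≠ x' →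
      ∑ M : ι → Fin n → ZMod 2, (if applyRows M x = applyRows M x' then (1 : ℝ) else 0) =
        Fintype.card (ι → Fin n → ZMod 2) * (1 / 2) ^ Fintype.card ι := by
    intro x x' hne
    have hv : x + x' ≠ 0 := by
      intro h
      refine hne (funext fun c => ?_)
      have := congrFun h c
      simp only [Pi.add_apply, Pi.zero_apply] at this
      generalize x c = u at this
      generalize x' c = u' at this
      revert u u'
      decide
    have hind : ∀ M : ι → Fin n → ZMod 2,
        (if applyRows M x = applyRows M x' then (1 : ℝ) else 0) =
          ∏ i, (1 / 2 + 1 / 2 * signChar (∑ c, M i c * (x + x') c)) := by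
      intro M
      have hrow : ∀ i, (1 / 2 + 1 / 2 * signChar (∑ c, M i c * (x + x') c) : ℝ) =
          if applyRows M x i = applyRows M x' i then 1 else 0 := by
        intro i
        simp only [Pi.add_apply, mul_add, Finset.sum_add_distrib]
        change (1 / 2 + 1 / 2 * signChar (applyRows M x i + applyRows M x' i) : ℝ) = _
        rw [signChar_add]
        generalize applyRows M x i = u
        generalize applyRows M x' i = u'
        rcases zmod_two_cases u with rfl | rfl <;> rcases zmod_two_cases u' with rfl | rfl <;>
          norm_num [signChar_zero, signChar_one]
      simp only [hrow]
      rw [Finset.prod_ite_zero]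
      simp [funext_iff]
    simp only [hind]
    have hprod := Finset.prod_univ_sum (fun _ : ι => (Finset.univ : Finset (Fin n → ZMod 2)))
      (fun _ u => (1 / 2 + 1 / 2 * signChar (∑ c, u c * (x + x') c) : ℝ))
    rw [Fintype.piFinset_univ] at hprod
    rw [← hprod]
    simp only [Finset.sum_add_distrib, ← Finset.mul_sum, sum_signChar_eq_zero hv]
    simp [mul_pow]
  have havg : ∑ M : ι → Fin n → ZMod 2,
      ∑ x, ∑ x', (if applyRows M x = applyRows M x' then p x * p x' else 0) ≤
        ∑ _M : ι → Fin n → ZMod 2, 2 * (1 / 2 : ℝ) ^ Fintype.card ι := by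
    -- Off the diagonal a random map collides with probability `2^{-|ι|}`; on it, `p x * p x ≤ p x *
    -- 2^{-|ι|}`. Each part contributes one half of the factor `2`.
    have hterm : ∀ x x' : Fin n → ZMod 2, ∑ M : ι → Fin n → ZMod 2,
        (if applyRows M x = applyRows M x' then p x * p x' else 0) ≤
          (p x * p x' + if x = x' then p x else 0) *
            (Fintype.card (ι → Fin n → ZMod 2) * (1 / 2) ^ Fintype.card ι) := by
      intro x x'
      have hc : (0 : ℝ) ≤ Fintype.card (ι → Fin n → ZMod 2) * (1 / 2) ^ Fintype.card ι := by
        positivity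
      have hpp := mul_nonneg (hp0 x) (hp0 x')
      by_cases hx : x = x'
      · subst hx
        simp only [if_true, Finset.sum_const, Finset.card_univ, nsmul_eq_mul]
        have : p x * p x ≤ p x * (1 / 2) ^ Fintype.card ι :=
          mul_le_mul_of_nonneg_left (hp x) (hp0 x)
        have h2 := mul_le_mul_of_nonneg_left this
          (Nat.cast_nonneg (α := ℝ) (Fintype.card (ι → Fin n → ZMod 2)))
        have h3 := mul_nonneg hpp hc
        linarith
      · rw [if_neg hx, add_zero, ← hcount x x' hx, Finset.mul_sum]
        exact le_of_eq (Finset.sum_congr rfl fun M _ => by split_ifs <;> simp)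
    rw [Finset.sum_comm]
    calc _ ≤ ∑ x, ∑ x', (p x * p x' + if x = x' then p x else 0) *
            (Fintype.card (ι → Fin n → ZMod 2) * (1 / 2) ^ Fintype.card ι) := by
          refine Finset.sum_le_sum fun x _ => ?_
          rw [Finset.sum_comm]
          exact Finset.sum_le_sum fun x' _ => hterm x x'
      _ = _ := by
          simp only [← Finset.sum_mul, Finset.sum_add_distrib, ← Finset.mul_sum, hp1,
            Finset.sum_ite_eq, Finset.mem_univ, if_true, mul_one]
          rw [Finset.sum_const, Finset.card_univ, nsmul_eq_mul]
          ring
  obtain ⟨M, _, hM⟩ := Finset.exists_le_of_sum_le Finset.univ_nonempty havg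
  exact ⟨M, hM⟩

/-! ### Moment bound for the truncated source -/

-- Only monomials with exactly one variable from the first block are used: one such variable times
-- degree `< e` in the second block has degree at most `e`.
open Classical in
theorem card_monomialSumsVanish_le {a b e r l t : ℕ} (hlb : l ≤ b)
    (hr : r ≤ lowWeightCount e (2 ^ l)) (hrt : r ≤ t) :
    (Finset.univ.filter fun y : Fin t → Fin a ⊕ Fin b → ZMod 2 =>
      MonomialSumsVanish e y).card ≤
        2 ^ (b * t) * 2 ^ (a * (t - r)) + 2 ^ t * 2 ^ (b * r + l * (t - r)) * 2 ^ (a * t) := by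
  have h := card_annihilating_pairs_le (a := a) (τ := Fin t) hlb hr (by simpa using hrt)
  rw [Fintype.card_fin] at h
  refine le_trans (Finset.card_le_card_of_injOn
    (fun y => (fun j i => y j (Sum.inl i), fun j c => y j (Sum.inr c))) ?_ ?_) h
  · intro y hy
    simp only [Finset.coe_filter, Finset.mem_univ, true_and, Set.mem_ofPred_eq] at hy ⊢
    intro i S hS
    have hi : (Sum.inl i : Fin a ⊕ Fin b) ∉ S.map Function.Embedding.inr := by simp
    have := hy (insert (Sum.inl i) (S.map Function.Embedding.inr))
      (by rw [Finset.card_insert_of_notMem hi, Finset.card_map]; omega)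
    simpa [monomialFun, Finset.prod_insert hi] using this
  · intro y _ y' _ hyy
    funext j i
    cases i with
    | inl i => exact congrFun (congrFun (congrArg Prod.fst hyy) j) i
    | inr c => exact congrFun (congrFun (congrArg Prod.snd hyy) j) c

open Classical in
theorem sum_tuples_fiberwise {A B : Type*} [Fintype A] [Fintype B] (t : ℕ) (L : A → B)
    (H : (Fin t → B) → Prop) (w : A → ℝ) :
    (∑ x : Fin t → A, if H (fun j => L (x j)) then ∏ j, w (x j) else 0) =
      ∑ y : Fin t → B, if H y then ∏ j, ∑ x ∈ Finset.univ.filter (fun x => L x = y j), w x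
        else 0 := by
  rw [← Finset.sum_fiberwise Finset.univ (fun (x : Fin t → A) j => L (x j))]
  refine Finset.sum_congr rfl fun y _ => ?_
  rw [Finset.prod_univ_sum]
  have : (Finset.univ.filter fun x : Fin t → A => (fun j => L (x j)) = y) =
      Fintype.piFinset fun j => Finset.univ.filter (fun x => L x = y j) := by
    ext x
    simp [funext_iff]
  rw [this]
  split_ifs with hy
  · refine Finset.sum_congr rfl fun x hx => ?_
    have hx' : (fun j => L (x j)) = y := by
      funext j
      simpa using Fintype.mem_piFinset.1 hx j
    rw [hx', if_pos hy]
  · refine Finset.sum_eq_zero fun x hx => ?_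
    have hx' : (fun j => L (x j)) = y := by
      funext j
      simpa using Fintype.mem_piFinset.1 hx j
    rw [hx', if_neg hy]

/-- A distribution with small point masses agrees, up to mass `2^{-s}`, with a subdistribution on
which the moments of the bias of a random polynomial are small. -/
theorem exists_subdistribution_moment_le {n d r l s : ℕ} (p : (Fin n → ZMod 2) → ℝ)
    (hp0 : ∀ x, 0 ≤ p x) (hp1 : ∑ x, p x = 1)
    (hp : ∀ x, p x ≤ (1 / 2) ^ (l + 6 * s + 8))
    (hr0 : 1 ≤ r) (hr : r ≤ lowWeightCount d (2 ^ l)) :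
    ∃ w : (Fin n → ZMod 2) → ℝ, (∀ x, w x ≤ p x) ∧ ∑ x, (p x - w x) ≤ (1 / 2) ^ s ∧
      ∑ α : PolyCoeffs n d, (∑ x, w x * signChar (evalPoly α x)) ^ (2 * r) ≤
        Fintype.card (PolyCoeffs n d) * (1 / 2) ^ (r * s) := by
  classical
  -- These sizes make the two terms of `card_monomialSumsVanish_le` equal when `t = 2 * r`.
  set a := 3 * s + 3 with ha
  set b := l + 3 * s + 5 with hb
  have hm : Fintype.card (Fin a ⊕ Fin b) = l + 6 * s + 8 := by
    simp only [Fintype.card_sum, Fintype.card_fin]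
    omega
  obtain ⟨M, hM⟩ := exists_rows_collision_le (ι := Fin a ⊕ Fin b) p hp0 hp1 (by rwa [hm])
  rw [hm] at hM
  set m := l + 6 * s + 8 with hmdef
  let q : (Fin a ⊕ Fin b → ZMod 2) → ℝ := fun y =>
    ∑ x ∈ Finset.univ.filter (fun x => applyRows M x = y), p x
  -- `D` is `2^s` times the collision bound, so by Markov's inequality fibres heavier than `D` carry
  -- mass at most `2^{-s}`.
  let D : ℝ := 2 ^ (s + 1) * (1 / 2) ^ m
  have hD : 0 < D := by positivity
  let w : (Fin n → ZMod 2) → ℝ := fun x => if q (applyRows M x) ≤ D then p x else 0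
  have hq0 : ∀ y, 0 ≤ q y := fun y => Finset.sum_nonneg fun x _ => hp0 x
  have hw0 : ∀ x, 0 ≤ w x := fun x => by
    simp only [w]
    split_ifs
    exacts [hp0 x, le_rfl]
  have hwp : ∀ x, w x ≤ p x := fun x => by
    simp only [w]
    split_ifs
    exacts [le_rfl, hp0 x]
  refine ⟨w, hwp, ?_, ?_⟩
  · have hcol : ∑ x, p x * q (applyRows M x) ≤ 2 * (1 / 2) ^ m := by
      refine le_trans (le_of_eq (Finset.sum_congr rfl fun x _ => ?_)) hM
      simp only [q, Finset.mul_sum, Finset.sum_filter]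
      refine Finset.sum_congr rfl fun x' _ => ?_
      simp only [eq_comm (a := applyRows M x')]
      split_ifs <;> simp
    have hmul : D * ∑ x, (p x - w x) ≤ 2 * (1 / 2) ^ m := by
      refine le_trans ?_ hcol
      rw [Finset.mul_sum]
      refine Finset.sum_le_sum fun x _ => ?_
      simp only [w]
      split_ifs with h
      · simpa using mul_nonneg (hp0 x) (hq0 _)
      · rw [sub_zero, mul_comm]
        exact mul_le_mul_of_nonneg_left (not_le.1 h).le (hp0 x)
    have hDs : D * (1 / 2) ^ s = 2 * (1 / 2) ^ m := by
      have : (2 : ℝ) ^ s * (1 / 2) ^ s = 1 := by rw [← mul_pow]; norm_num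
      simp only [D, pow_succ]
      linear_combination (2 * (1 / 2 : ℝ) ^ m) * this
    exact le_of_mul_le_mul_left (hmul.trans_eq hDs.symm) hD
  · rw [sum_pow_signChar_evalPoly]
    refine mul_le_mul_of_nonneg_left ?_ (Nat.cast_nonneg _)
    have hqw : ∀ y, ∑ x ∈ Finset.univ.filter (fun x => applyRows M x = y), w x ≤ D := by
      intro y
      by_cases hy : q y ≤ D
      · exact (Finset.sum_le_sum fun x _ => hwp x).trans hy
      · refine (le_of_eq (Finset.sum_eq_zero fun x hx => ?_)).trans hD.le
        rw [Finset.mem_filter] at hx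
        simp only [w, hx.2, if_neg hy]
    calc _ ≤ ∑ x : Fin (2 * r) → Fin n → ZMod 2,
          if MonomialSumsVanish d (fun j => applyRows M (x j)) then ∏ j, w (x j) else 0 := by
          refine Finset.sum_le_sum fun x _ => ?_
          by_cases hx : MonomialSumsVanish d x
          · rw [if_pos hx, if_pos (hx.applyRows M)]
          · rw [if_neg hx]
            split_ifs
            exacts [Finset.prod_nonneg fun j _ => hw0 _, le_rfl]
      _ = ∑ y : Fin (2 * r) → Fin a ⊕ Fin b → ZMod 2, if MonomialSumsVanish d y then
            ∏ j, ∑ x ∈ Finset.univ.filter (fun x => applyRows M x = y j), w x else 0 :=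
          by
          convert! sum_tuples_fiberwise (2 * r) (applyRows M) (fun y => MonomialSumsVanish d y) w
      _ ≤ ∑ y : Fin (2 * r) → Fin a ⊕ Fin b → ZMod 2,
            if MonomialSumsVanish d y then D ^ (2 * r) else 0 := by
          refine Finset.sum_le_sum fun y _ => ?_
          split_ifs
          · refine (Finset.prod_le_prod (fun j _ => Finset.sum_nonneg fun x _ => hw0 x)
              fun j _ => hqw (y j)).trans (by simp)
          · exact le_rfl
      _ = (Finset.univ.filter fun y : Fin (2 * r) → Fin a ⊕ Fin b → ZMod 2 =>
            MonomialSumsVanish d y).card * D ^ (2 * r) := by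
          rw [← Finset.sum_filter, Finset.sum_const, nsmul_eq_mul]
      _ ≤ (2 ^ (b * (2 * r)) * 2 ^ (a * (2 * r - r)) +
            2 ^ (2 * r) * 2 ^ (b * r + l * (2 * r - r)) * 2 ^ (a * (2 * r)) : ℕ) *
            D ^ (2 * r) := by
          gcongr
          exact card_monomialSumsVanish_le (by omega) hr (by omega)
      _ ≤ (1 / 2) ^ (r * s) := by
          have hexp : 2 ^ (b * (2 * r)) * 2 ^ (a * (2 * r - r)) +
              2 ^ (2 * r) * 2 ^ (b * r + l * (2 * r - r)) * 2 ^ (a * (2 * r)) =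
                2 ^ (1 + r * (2 * l + 9 * s + 13)) := by
            rw [show 2 * r - r = r by omega, ← pow_add, ← pow_add, ← pow_add, ha, hb,
              show (l + 3 * s + 5) * (2 * r) + (3 * s + 3) * r = r * (2 * l + 9 * s + 13) by ring,
              show 2 * r + ((l + 3 * s + 5) * r + l * r) + (3 * s + 3) * (2 * r) =
                r * (2 * l + 9 * s + 13) by ring]
            ring
          rw [hexp]
          simp only [D, mul_pow, ← pow_mul]
          push_cast
          rw [← mul_assoc, ← pow_add, one_div, inv_pow, inv_pow, ← div_eq_mul_inv,
            div_le_iff₀ (by positivity), inv_mul_eq_div, le_div_iff₀ (by positivity), ← pow_add]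
          refine pow_le_pow_right₀ (by norm_num) ?_
          -- The exponents leave `1 - r - r * s`, at most `-(r * s)` because `1 ≤ r`.
          rw [hmdef]
          nlinarith

/-! ### From moments to tail bounds -/

theorem bias_eq_sum {n : ℕ} (X : PMF (Fin n → ZMod 2)) (f : (Fin n → ZMod 2) → ZMod 2) :
    bias X f = ∑ x, (X x).toReal * signChar (f x) := by
  classical
  have h : ∀ u, (X.toOuterMeasure {x | f x = u}).toReal =
      ∑ x, if f x = u then (X x).toReal else 0 := by
    intro u
    rw [PMF.toOuterMeasure_apply_fintype, ENNReal.toReal_sum]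
    · refine Finset.sum_congr rfl fun x _ => ?_
      rw [Set.indicator_apply]
      simp only [Set.mem_ofPred_eq]
      split_ifs <;> simp
    · intro x _
      rw [Set.indicator_apply]
      split_ifs
      exacts [X.apply_ne_top x, ENNReal.zero_ne_top]
  rw [bias, h, h, ← Finset.sum_sub_distrib]
  refine Finset.sum_congr rfl fun x _ => ?_
  rcases zmod_two_cases (f x) with h | h <;> simp [h, signChar_zero, signChar_one]

theorem sum_toReal_eq_one {α : Type*} [Fintype α] (X : PMF α) : ∑ x, (X x).toReal = 1 := by
  rw [← ENNReal.toReal_sum fun x _ => X.apply_ne_top x, ← tsum_fintype (L := .unconditional α),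
    X.tsum_coe, ENNReal.toReal_one]

theorem toReal_le_of_le_minEntropy {α : Type*} [Finite α] (X : PMF α) {k : ℝ}
    (hk : k ≤ minEntropy X) (x : α) : (X x).toReal ≤ (2 : ℝ) ^ (-k) := by
  by_cases hx : x ∈ X.support
  · have hpos : 0 < (X x).toReal :=
      ENNReal.toReal_pos ((X.mem_support_iff x).1 hx) (X.apply_ne_top x)
    have h : k ≤ Real.logb 2 (1 / (X x).toReal) :=
      hk.trans (ciInf_le (Set.finite_range _).bddBelow (⟨x, hx⟩ : X.support))
    rw [Real.le_logb_iff_rpow_le (by norm_num) (by positivity), le_div_iff₀ hpos] at h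
    rw [Real.rpow_neg (by norm_num), ← one_div, le_div_iff₀ (by positivity), mul_comm]
    exact h
  · rw [PMF.mem_support_iff, not_not] at hx
    rw [hx, ENNReal.toReal_zero]
    positivity

/-- Markov's inequality for an even moment over random polynomials. -/
theorem randomPoly_toOuterMeasure_le {n d : ℕ} (E : Set (PolyCoeffs n d))
    (W : PolyCoeffs n d → ℝ) (r : ℕ) {η B : ℝ} (hη : 0 < η) (hE : ∀ α ∈ E, η ≤ |W α|)
    (hB : ∑ α, W α ^ (2 * r) ≤ Fintype.card (PolyCoeffs n d) * B) :
    ((randomPoly n d).toOuterMeasure E).toReal ≤ B / η ^ (2 * r) := by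
  classical
  have hcard : (0 : ℝ) < Fintype.card (PolyCoeffs n d) := by
    exact_mod_cast Fintype.card_pos
  rw [randomPoly, PMF.toOuterMeasure_uniformOfFintype_apply, ENNReal.toReal_div,
    ENNReal.toReal_natCast, ENNReal.toReal_natCast, div_le_iff₀ hcard, div_mul_eq_mul_div,
    le_div_iff₀ (by positivity), mul_comm B]
  refine le_trans ?_ hB
  rw [Fintype.card_subtype, ← nsmul_eq_mul]
  calc _ ≤ ∑ α ∈ Finset.univ.filter (· ∈ E), W α ^ (2 * r) := by
        refine Finset.card_nsmul_le_sum _ _ _ fun α hα => ?_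
        rw [← (even_two_mul r).pow_abs (W α)]
        exact pow_le_pow_left₀ hη.le (hE α (Finset.mem_filter.1 hα).2) _
    _ ≤ _ := by
        refine Finset.sum_le_sum_of_subset_of_nonneg (Finset.subset_univ _) fun α _ _ => ?_
        exact (even_two_mul r).pow_nonneg _

theorem prob_bias_le_of_dimension {n d r l s : ℕ} (X : PMF (Fin n → ZMod 2)) {k θ : ℝ}
    (hX : k ≤ minEntropy X) (hk : ((l + 6 * s + 8 : ℕ) : ℝ) ≤ k) (hs : 8 ≤ s)
    (hθ : θ ≤ s / 8) (hr0 : 1 ≤ r) (hr : r ≤ lowWeightCount d (2 ^ l)) :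
    ((randomPoly n d).toOuterMeasure {α | (2 : ℝ) ^ (-θ) < |bias X (evalPoly α)|}).toReal ≤
      (2 : ℝ) ^ (-(r * s / 2 : ℝ)) := by
  have hp : ∀ x, (X x).toReal ≤ (1 / 2) ^ (l + 6 * s + 8) := by
    intro x
    refine (toReal_le_of_le_minEntropy X hX x).trans ?_
    rw [one_div, inv_pow, ← Real.rpow_natCast, ← Real.rpow_neg (by norm_num)]
    exact Real.rpow_le_rpow_of_exponent_le (by norm_num) (by linarith)
  obtain ⟨w, hwp, hdiff, hmom⟩ := exists_subdistribution_moment_le (d := d)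
    (fun x => (X x).toReal) (fun x => ENNReal.toReal_nonneg) (sum_toReal_eq_one X) hp hr0 hr
  set u : ℝ := (2 : ℝ) ^ (-(s / 8 : ℝ)) with hu
  have hu0 : 0 < u := by positivity
  have hupow : ∀ m : ℕ, u ^ m = (2 : ℝ) ^ (-(s / 8 * m : ℝ)) := by
    intro m
    rw [hu, ← Real.rpow_natCast, ← Real.rpow_mul (by norm_num)]
    ring_nf
  have hus : ∀ m : ℕ, (1 / 2 : ℝ) ^ (m * s) = u ^ (8 * m) := by
    intro m
    rw [hupow, one_div, inv_pow, ← Real.rpow_natCast, ← Real.rpow_neg (by norm_num)]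
    congr 1
    push_cast
    ring
  have hu1 : u ≤ 1 / 2 := by
    have : (2 : ℝ) ^ (-(s / 8 : ℝ)) ≤ (2 : ℝ) ^ (-1 : ℝ) := by
      refine Real.rpow_le_rpow_of_exponent_le (by norm_num) ?_
      have : (8 : ℝ) ≤ s := by exact_mod_cast hs
      linarith
    rw [Real.rpow_neg_one] at this
    linarith
  have huθ : u ≤ (2 : ℝ) ^ (-θ) :=
    Real.rpow_le_rpow_of_exponent_le (by norm_num) (by linarith)
  -- The bias exceeds `u` and truncation costs at most `2^{-s} = u ^ 8`, so the truncated sum is at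
  -- least `u ^ 2`. Markov's inequality then yields `u^{8r} / u^{4r}`.
  have hgap : u ^ 2 + u ^ 8 ≤ u := by
    have h8 : u ^ 8 ≤ u ^ 2 := pow_le_pow_of_le_one hu0.le (by linarith) (by norm_num)
    nlinarith
  have h1 := hus 1
  rw [one_mul, mul_one] at h1
  refine (randomPoly_toOuterMeasure_le _ _ r (η := u ^ 2) (by positivity) ?_ hmom).trans
    (le_of_eq ?_)
  · intro α hα
    rw [Set.mem_ofPred_eq, bias_eq_sum] at hα
    have htri : |∑ x, (X x).toReal * signChar (evalPoly α x)| ≤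
        |∑ x, w x * signChar (evalPoly α x)| + ∑ x, ((X x).toReal - w x) := by
      have : ∑ x, (X x).toReal * signChar (evalPoly α x) =
          ∑ x, w x * signChar (evalPoly α x) +
            ∑ x, ((X x).toReal - w x) * signChar (evalPoly α x) := by
        rw [← Finset.sum_add_distrib]
        exact Finset.sum_congr rfl fun x _ => by ring
      rw [this]
      refine (abs_add_le _ _).trans (add_le_add le_rfl ?_)
      refine (Finset.abs_sum_le_sum_abs _ _).trans (Finset.sum_le_sum fun x _ => ?_)
      rw [abs_mul, abs_signChar, mul_one, abs_of_nonneg (sub_nonneg.2 (hwp x))]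
    linarith
  · rw [hus, ← pow_mul, show 8 * r = 4 * r + 2 * (2 * r) by ring, pow_add,
      mul_div_cancel_right₀ _ (by positivity), hupow]
    congr 1
    push_cast
    ring

/-- As `1 ≤ d`, the linear monomials force the two points of a vanishing pair to coincide, so the
second moment is at most the collision probability. -/
theorem prob_bias_le_of_second_moment {n d : ℕ} (hd : 1 ≤ d) (X : PMF (Fin n → ZMod 2)) {k θ : ℝ}
    (hX : k ≤ minEntropy X) :
    ((randomPoly n d).toOuterMeasure {α | (2 : ℝ) ^ (-θ) < |bias X (evalPoly α)|}).toReal ≤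
      (2 : ℝ) ^ (2 * θ - k) := by
  classical
  refine (randomPoly_toOuterMeasure_le _ (fun α => bias X (evalPoly α)) 1
    (η := (2 : ℝ) ^ (-θ)) (B := (2 : ℝ) ^ (-k)) (by positivity) (fun α hα => le_of_lt hα) ?_).trans
    (le_of_eq ?_)
  · simp only [bias_eq_sum]
    rw [sum_pow_signChar_evalPoly]
    refine mul_le_mul_of_nonneg_left ?_ (Nat.cast_nonneg _)
    calc _ ≤ ∑ x : Fin (2 * 1) → Fin n → ZMod 2,
          if x 0 = x 1 then (X (x 0)).toReal * (X (x 1)).toReal else 0 := by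
          refine Finset.sum_le_sum fun x _ => ?_
          by_cases hx : MonomialSumsVanish d x
          · have h01 : x 0 = x 1 := by
              funext c
              have : ∑ j : Fin 2, monomialFun {c} (x j) = 0 := hx {c} (by simpa using hd)
              simp only [monomialFun, Finset.prod_singleton, Fin.sum_univ_two] at this
              generalize x 0 c = u at this
              generalize x 1 c = u' at this
              revert u u'
              decide
            rw [if_pos hx, if_pos h01]
            simp [Fin.prod_univ_two]
          · rw [if_neg hx]
            split_ifs
            exacts [mul_nonneg ENNReal.toReal_nonneg ENNReal.toReal_nonneg, le_rfl]
      _ = ∑ z : (Fin n → ZMod 2) × (Fin n → ZMod 2),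
          if z.1 = z.2 then (X z.1).toReal * (X z.2).toReal else 0 :=
          Fintype.sum_equiv (finTwoArrowEquiv _) _ _ fun x => rfl
      _ = ∑ x, (X x).toReal * (X x).toReal := by
          simp [Fintype.sum_prod_type]
      _ ≤ ∑ x, (X x).toReal * (2 : ℝ) ^ (-k) :=
          Finset.sum_le_sum fun x _ => mul_le_mul_of_nonneg_left
            (toReal_le_of_le_minEntropy X hX x) ENNReal.toReal_nonneg
      _ = _ := by rw [← Finset.sum_mul, sum_toReal_eq_one, one_mul]
  · rw [← Real.rpow_natCast, ← Real.rpow_mul (by norm_num), ← Real.rpow_sub (by norm_num)]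
    congr 1
    push_cast
    ring

/-! ### Binomial estimates -/

theorem ring_choose_eq_prod_div (k : ℝ) (i : ℕ) :
    Ring.choose k i = (∏ j ∈ Finset.range i, (k - j)) / i.factorial := by
  have h : ∀ i : ℕ, (descPochhammer ℤ i).smeval k = ∏ j ∈ Finset.range i, (k - j) := by
    intro i
    induction i with
    | zero => simp
    | succ i ih =>
      rw [descPochhammer_succ_right, Polynomial.smeval_mul, ih, Finset.prod_range_succ,
        Polynomial.smeval_sub, Polynomial.smeval_X, Polynomial.smeval_natCast]
      simp
  rw [eq_div_iff (by exact_mod_cast i.factorial_ne_zero), ← h,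
    Ring.descPochhammer_eq_factorial_smul_choose, nsmul_eq_mul, mul_comm]

theorem ring_choose_le_natCeil {k : ℝ} {i : ℕ} (hi : (i : ℝ) ≤ k) :
    Ring.choose k i ≤ (⌈k⌉₊.choose i : ℝ) := by
  rw [← Ring.choose_natCast, ring_choose_eq_prod_div, ring_choose_eq_prod_div]
  refine div_le_div_of_nonneg_right ?_ (Nat.cast_nonneg _)
  refine Finset.prod_le_prod (fun j hj => ?_) fun j _ => ?_
  · have : (j : ℝ) < i := by exact_mod_cast Finset.mem_range.1 hj
    linarith
  · linarith [Nat.le_ceil k]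

theorem binomSum_le_natCeil {k : ℝ} {d : ℕ} (hd : (d : ℝ) ≤ k) :
    binomSum k d ≤ ∑ i ∈ Finset.range (d + 1), (⌈k⌉₊.choose i : ℝ) := by
  refine Finset.sum_le_sum fun i hi => ring_choose_le_natCeil ?_
  have : (i : ℝ) ≤ d := by exact_mod_cast Nat.lt_succ_iff.1 (Finset.mem_range.1 hi)
  linarith

theorem sum_choose_succ_le {K d : ℕ} (hd : 1 ≤ d) (hK : d ≤ K) :
    ∑ i ∈ Finset.range (d + 1), (K.choose i : ℝ) ≤
      2 * (K / d) * ∑ i ∈ Finset.range d, (K.choose i : ℝ) := by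
  set B := ∑ i ∈ Finset.range d, (K.choose i : ℝ) with hB
  have hd0 : (0 : ℝ) < d := by exact_mod_cast hd
  have hB0 : 0 ≤ B := Finset.sum_nonneg fun i _ => Nat.cast_nonneg _
  have h1 : (1 : ℝ) ≤ K / d := by
    rw [le_div_iff₀ hd0, one_mul]
    exact_mod_cast hK
  have htop : (K.choose d : ℝ) ≤ K / d * B := by
    obtain ⟨e, rfl⟩ := Nat.exists_eq_add_of_le' hd
    have hmem : (K.choose e : ℝ) ≤ B :=
      Finset.single_le_sum (f := fun i => (K.choose i : ℝ)) (fun i _ => Nat.cast_nonneg _)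
        (Finset.self_mem_range_succ e)
    have hrec : (K.choose (e + 1) : ℝ) * ((e + 1 : ℕ) : ℝ) = K.choose e * ((K - e : ℕ) : ℝ) := by
      exact_mod_cast Nat.choose_succ_right_eq K e
    have hKe : ((K - e : ℕ) : ℝ) ≤ K := by exact_mod_cast Nat.sub_le K e
    rw [div_mul_eq_mul_div, le_div_iff₀ hd0, hrec, mul_comm]
    exact mul_le_mul hKe hmem (Nat.cast_nonneg _) (Nat.cast_nonneg _)
  rw [Finset.sum_range_succ, ← hB]
  nlinarith

/-- Each unit of dimension costs a factor `C(N,i) / C(N+1,i) = 1 - i/(N+1) ≥ 1 - x`. -/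
theorem one_sub_pow_mul_sum_choose_le {l d : ℕ} {x : ℝ} (hx0 : 0 ≤ x) (hx1 : x ≤ 1)
    (hx : (d : ℝ) ≤ x * l) (D : ℕ) :
    (1 - x) ^ D * ∑ i ∈ Finset.range d, ((l + D).choose i : ℝ) ≤
      ∑ i ∈ Finset.range d, (l.choose i : ℝ) := by
  induction D with
  | zero => simp
  | succ D ih =>
    refine le_trans ?_ ih
    rw [pow_succ, mul_assoc]
    refine mul_le_mul_of_nonneg_left ?_ (pow_nonneg (by linarith) _)
    rw [Finset.mul_sum]
    refine Finset.sum_le_sum fun i hi => ?_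
    have hid : (i : ℝ) ≤ d := by exact_mod_cast (Finset.mem_range.1 hi).le
    have hld : (d : ℝ) ≤ l := hx.trans (mul_le_of_le_one_left (Nat.cast_nonneg _) hx1)
    have hil : i ≤ l := by exact_mod_cast hid.trans hld
    have hrec : ((l + D).choose i : ℝ) * ((l + D + 1 : ℕ) : ℝ) =
        ((l + D + 1).choose i : ℝ) * ((l + D + 1 - i : ℕ) : ℝ) := by
      exact_mod_cast Nat.choose_mul_succ_eq (l + D) i
    rw [Nat.cast_sub (by omega)] at hrec
    rw [← add_assoc]
    have hpos : (0 : ℝ) < ((l + D + 1 : ℕ) : ℝ) := by positivity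
    refine le_of_mul_le_mul_right ?_ hpos
    rw [hrec, mul_comm (1 - x), mul_assoc]
    refine mul_le_mul_of_nonneg_left ?_ (Nat.cast_nonneg _)
    have : x * l ≤ x * ((l + D + 1 : ℕ) : ℝ) :=
      mul_le_mul_of_nonneg_left (by exact_mod_cast (by omega)) hx0
    linarith

/-- `1/(1-x) = 1 + x/(1-x) ≤ 1 + 2x/δ`, as `1 - x ≥ δ/2`. -/
theorem exp_neg_le_one_sub {δ x : ℝ} (hδ : 0 < δ) (hx0 : 0 ≤ x) (hx : x ≤ 1 - δ / 2) :
    Real.exp (-(2 * x / δ)) ≤ 1 - x := by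
  have h1 : 2 * x / δ + 1 ≤ Real.exp (2 * x / δ) := Real.add_one_le_exp _
  have h2 : 1 ≤ (1 - x) * (2 * x / δ + 1) := by
    have : (1 - x) * (2 * x / δ + 1) - 1 = x * (2 - δ - 2 * x) / δ := by
      field_simp
      ring
    have h3 : 0 ≤ x * (2 - δ - 2 * x) / δ :=
      div_nonneg (mul_nonneg hx0 (by linarith)) hδ.le
    linarith
  rw [Real.exp_neg, inv_le_iff_one_le_mul₀ (Real.exp_pos _)]
  exact h2.trans (mul_le_mul_of_nonneg_left h1 (by linarith))

/-- Lowering the dimension by `D` costs a bounded factor when `d D / l` is bounded. -/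
theorem sum_choose_add_le {l d D : ℕ} {δ T : ℝ} (hδ : 0 < δ) (hl : 0 < l)
    (hd : (d : ℝ) ≤ (1 - δ / 2) * l) (hT : (d : ℝ) * D ≤ T * l) :
    ∑ i ∈ Finset.range d, ((l + D).choose i : ℝ) ≤
      Real.exp (2 * T / δ) * ∑ i ∈ Finset.range d, (l.choose i : ℝ) := by
  have hl' : (0 : ℝ) < l := by exact_mod_cast hl
  set x : ℝ := d / l with hx
  have hx0 : 0 ≤ x := by positivity
  have hxδ : x ≤ 1 - δ / 2 := by rwa [hx, div_le_iff₀ hl']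
  have hxl : x * l = d := by rw [hx]; field_simp
  have hxD : x * D ≤ T := by
    rw [hx, div_mul_eq_mul_div, div_le_iff₀ hl']
    exact hT
  have h := one_sub_pow_mul_sum_choose_le hx0 (by linarith) hxl.ge D
  have hexp : Real.exp (-(2 * T / δ)) ≤ (1 - x) ^ D := by
    refine le_trans ?_ (pow_le_pow_left₀ (Real.exp_pos _).le (exp_neg_le_one_sub hδ hx0 hxδ) D)
    rw [← Real.exp_nat_mul, Real.exp_le_exp,
      show (D : ℝ) * -(2 * x / δ) = -(2 * (x * D) / δ) by ring]
    gcongr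
  have hB : 0 ≤ ∑ i ∈ Finset.range d, ((l + D).choose i : ℝ) :=
    Finset.sum_nonneg fun i _ => Nat.cast_nonneg _
  have h' := (mul_le_mul_of_nonneg_right hexp hB).trans h
  rwa [Real.exp_neg, inv_mul_le_iff₀ (Real.exp_pos _)] at h'

/-! ### Choice of parameters -/

theorem prob_bias_le_of_large {δ : ℝ} (hδ0 : 0 < δ) (hδ1 : δ < 1) {c : ℝ} (hc0 : 0 < c)
    (hc : c ≤ δ / 192 * Real.exp (-(260 / δ))) {n d : ℕ} (X : PMF (Fin n → ZMod 2)) {k : ℝ}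
    (hX : k ≤ minEntropy X) (hd : 1 ≤ d) (hdk : (d : ℝ) ≤ (1 - δ) * k) (hk : 256 / δ ≤ k) :
    ((randomPoly n d).toOuterMeasure
        {α | (2 : ℝ) ^ (-(c * k / d)) < |bias X (evalPoly α)|}).toReal ≤
      (2 : ℝ) ^ (-(c * binomSum k d)) := by
  have hδk : 256 ≤ δ * k := by rwa [div_le_iff₀' hδ0] at hk
  have hk0 : 0 < k := lt_of_lt_of_le (by positivity) hk
  have hkδ : δ * k ≤ k := mul_le_of_le_one_left hk0.le hδ1.le
  have hd1 : (1 : ℝ) ≤ d := by exact_mod_cast hd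
  have hd0 : (0 : ℝ) < d := by linarith
  have hdk' : (d : ℝ) ≤ k := by linarith
  -- The dimension lost, `k - l`, is at most `6ρ + 63 ≤ δk/4 + 63`, which is below `δk/2` because
  -- `δk ≥ 256`. The `+ 8` in `s` secures `8 ≤ s`.
  set ρ : ℝ := δ / 24 * (k / d) with hρ
  have hρ0 : 0 ≤ ρ := by positivity
  have hdρ : d * ρ = δ / 24 * k := by rw [hρ]; field_simp
  have hρk : ρ ≤ δ / 24 * k := by
    rw [← hdρ]
    exact le_mul_of_one_le_left hρ0 hd1
  set s : ℕ := ⌈ρ⌉₊ + 8 with hs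
  have hs1 : ρ ≤ s := by
    rw [hs]; push_cast; linarith [Nat.le_ceil ρ]
  have hs2 : (s : ℝ) ≤ ρ + 9 := by
    rw [hs]; push_cast; linarith [Nat.ceil_lt_add_one hρ0]
  have hfl : k < ⌊k⌋₊ + 1 := Nat.lt_floor_add_one k
  have hfl' : (⌊k⌋₊ : ℝ) ≤ k := Nat.floor_le hk0.le
  have hce : (⌈k⌉₊ : ℝ) < k + 1 := Nat.ceil_lt_add_one hk0.le
  have hce' : k ≤ (⌈k⌉₊ : ℝ) := Nat.le_ceil k
  have hle : 6 * s + 8 ≤ ⌊k⌋₊ := by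
    have : ((6 * s + 8 : ℕ) : ℝ) < ((⌊k⌋₊ + 1 : ℕ) : ℝ) := by
      push_cast
      linarith
    have : 6 * s + 8 < ⌊k⌋₊ + 1 := by exact_mod_cast this
    omega
  obtain ⟨l, hl⟩ := Nat.exists_eq_add_of_le' hle
  have hlR : (⌊k⌋₊ : ℝ) = l + (6 * s + 8) := by rw [hl]; push_cast; ring
  obtain ⟨D, hD⟩ := Nat.exists_eq_add_of_le
    (show l ≤ ⌈k⌉₊ from (by omega : l ≤ ⌊k⌋₊).trans (Nat.floor_le_ceil k))
  have hDR : (⌈k⌉₊ : ℝ) = l + D := by rw [hD]; push_cast; ring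
  have hD2 : (D : ℝ) ≤ 6 * ρ + 64 := by linarith
  have hlk : (1 - δ / 2) * k ≤ l := by linarith
  have hlk2 : k / 2 ≤ l := by linarith
  have hl0 : 0 < l := by
    have : (0 : ℝ) < l := by linarith
    exact_mod_cast this
  have hdl : (d : ℝ) ≤ (1 - δ / 2) * l := by
    refine le_trans ?_ (mul_le_mul_of_nonneg_left hlk (by linarith))
    nlinarith [mul_nonneg (sq_nonneg δ) hk0.le]
  -- `6dρ ≤ k/4` and `64d ≤ 64k`, while `130 l ≥ 65k`. This `130` is the source of `260 / δ`.
  have hdD : (d : ℝ) * D ≤ 130 * l := by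
    have := mul_le_mul_of_nonneg_left hD2 hd0.le
    linarith
  set r := lowWeightCount d (2 ^ l) with hr
  have hrR : (r : ℝ) = ∑ i ∈ Finset.range d, (l.choose i : ℝ) := by
    rw [hr, lowWeightCount_two_pow]
    push_cast
    rfl
  have hr1 : 1 ≤ r := by
    rw [hr, lowWeightCount_two_pow]
    exact (Nat.choose_zero_right l).ge.trans (Finset.single_le_sum (f := fun i => l.choose i)
      (fun i _ => Nat.zero_le _) (Finset.mem_range.2 hd))
  have hexp1 : Real.exp (-(260 / δ)) ≤ 1 := by
    rw [Real.exp_le_one_iff]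
    have : 0 < 260 / δ := by positivity
    linarith
  have hkd : 0 < k / d := by positivity
  have hθ : c * k / d ≤ s / 8 := by
    have h1 : c ≤ δ / 192 := hc.trans (mul_le_of_le_one_right (by positivity) hexp1)
    have h2 := mul_le_mul_of_nonneg_right h1 hkd.le
    rw [mul_div_assoc]
    linarith
  -- The factor `k / d`, lost in passing to binomials below `d`, is recovered from `s ≥ ρ`.
  have hbinom : binomSum k d ≤ 4 * (k / d) * (Real.exp (260 / δ) * r) := by
    have hK : d ≤ ⌈k⌉₊ := by exact_mod_cast hdk'.trans hce'
    have h1 := (binomSum_le_natCeil hdk').trans (sum_choose_succ_le hd hK)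
    have h2 := sum_choose_add_le hδ0 hl0 hdl hdD
    rw [← hD, ← hrR, show 2 * 130 / δ = 260 / δ by norm_num] at h2
    refine h1.trans (mul_le_mul ?_ h2 (Finset.sum_nonneg fun i _ => Nat.cast_nonneg _)
      (by positivity))
    have : (⌈k⌉₊ : ℝ) / d ≤ 2 * k / d := by
      gcongr
      linarith
    rw [mul_div_assoc] at this
    linarith
  refine (prob_bias_le_of_dimension X hX (l := l) (s := s) (r := r) ?_ (by omega) hθ hr1
    le_rfl).trans ?_
  · refine le_trans (le_of_eq ?_) hfl'
    rw [hl, add_assoc]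
  · refine Real.rpow_le_rpow_of_exponent_le (by norm_num) (neg_le_neg ?_)
    have hr0 : (0 : ℝ) ≤ r := Nat.cast_nonneg r
    have he : Real.exp (-(260 / δ)) * Real.exp (260 / δ) = 1 := by
      rw [← Real.exp_add, neg_add_cancel, Real.exp_zero]
    calc c * binomSum k d ≤ c * (4 * (k / d) * (Real.exp (260 / δ) * r)) :=
          mul_le_mul_of_nonneg_left hbinom hc0.le
      _ ≤ δ / 192 * Real.exp (-(260 / δ)) * (4 * (k / d) * (Real.exp (260 / δ) * r)) :=
          mul_le_mul_of_nonneg_right hc (by positivity)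
      _ = r * ρ / 2 := by
          rw [hρ]
          linear_combination (δ / 48 * (k / d) * r) * he
      _ ≤ r * s / 2 := by
          gcongr

theorem prob_bias_le_of_small {δ : ℝ} (hδ0 : 0 < δ) {N : ℕ} {c : ℝ} (hc0 : 0 < c)
    (hc : c ≤ 1 / 4 * (1 / 2) ^ N) {n d : ℕ} (X : PMF (Fin n → ZMod 2)) {k : ℝ}
    (hX : k ≤ minEntropy X) (hd : 1 ≤ d) (hdk : (d : ℝ) ≤ (1 - δ) * k) (hk0 : 0 < k)
    (hk : k ≤ N) :
    ((randomPoly n d).toOuterMeasure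
        {α | (2 : ℝ) ^ (-(c * k / d)) < |bias X (evalPoly α)|}).toReal ≤
      (2 : ℝ) ^ (-(c * binomSum k d)) := by
  have hd1 : (1 : ℝ) ≤ d := by exact_mod_cast hd
  have hδk : 0 < δ * k := mul_pos hδ0 hk0
  have hdk' : (d : ℝ) ≤ k := by linarith
  refine (prob_bias_le_of_second_moment hd X hX).trans
    (Real.rpow_le_rpow_of_exponent_le (by norm_num) ?_)
  have hc4 : c ≤ 1 / 4 :=
    hc.trans (mul_le_of_le_one_right (by norm_num) (pow_le_one₀ (by norm_num) (by norm_num)))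
  have h1 : c * k / d ≤ k / 4 := by
    rw [div_le_iff₀ (by linarith)]
    nlinarith
  have h2 : binomSum k d ≤ 2 ^ N := by
    refine (binomSum_le_natCeil hdk').trans ?_
    have hsum : ∑ i ∈ Finset.range (d + 1), ⌈k⌉₊.choose i ≤ 2 ^ N := by
      rw [← lowWeightCount_two_pow]
      refine (Finset.card_filter_le _ _).trans ?_
      rw [Finset.card_range]
      exact Nat.pow_le_pow_right (by norm_num) (Nat.ceil_le.2 hk)
    exact_mod_cast hsum
  have h3 : c * binomSum k d ≤ 1 / 4 := by
    calc c * binomSum k d ≤ c * 2 ^ N := mul_le_mul_of_nonneg_left h2 hc0.le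
      _ ≤ 1 / 4 * (1 / 2) ^ N * 2 ^ N := mul_le_mul_of_nonneg_right hc (by positivity)
      _ = 1 / 4 := by rw [mul_assoc, ← mul_pow]; norm_num
  -- The exponent is at most `k/2 - k ≤ -1/2`, because `k ≥ d ≥ 1`.
  linarith

theorem mainTheorem2 (δ : ℝ) (hδ0 : 0 < δ) (hδ1 : δ < 1) :
    ∃ c : ℝ, 0 < c ∧
      ∀ (n : ℕ) (X : PMF (Fin n → ZMod 2)) (k : ℝ), k ≤ minEntropy X →
        ∀ d : ℕ, 1 ≤ d → (d : ℝ) ≤ (1 - δ) * k →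
          ((randomPoly n d).toOuterMeasure
              {α | (2 : ℝ) ^ (-(c * k / d)) < |bias X (evalPoly α)|}).toReal
            ≤ (2 : ℝ) ^ (-(c * binomSum k d)) := by
  have hc : 0 < min (δ / 192 * Real.exp (-(260 / δ))) (1 / 4 * (1 / 2) ^ ⌈256 / δ⌉₊) := by
    positivity
  refine ⟨_, hc, fun n X k hX d hd hdk => ?_⟩
  have hd1 : (1 : ℝ) ≤ d := by exact_mod_cast hd
  have hk0 : 0 < k := by
    by_contra! h
    have := mul_nonpos_of_nonneg_of_nonpos (show 0 ≤ 1 - δ by linarith) h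
    linarith
  rcases le_total (256 / δ) k with hk | hk
  · exact prob_bias_le_of_large hδ0 hδ1 hc (min_le_left _ _) X hX hd hdk hk
  · exact prob_bias_le_of_small hδ0 hc (min_le_right _ _) X hX hd hdk hk0
      (hk.trans (Nat.le_ceil _))
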